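/- Let $p$ be a prime. For a commutative ring $A$ let $A[[t^{\mathbb Q}]]$ be the ring of generalized power series $\sum_{i\in\mathbb Q,\, i\ge 0} c_i t^i$ with $c_i\in A$ and $\{i : c_i\ne 0\}$ well-ordered. Let $R$ be either $\mathbb Z_p[[t^{\mathbb Q}]]/(t-p)$ or $W(\overline{\mathbb F}_p)[[t^{\mathbb Q}]]/(t-p)$ (the latter is Poonen's spherical completion of $\mathcal O_{\mathbb C_p}$). Notation: $W(R)$ is the ring of $p$-typical Witt vectors, $W_{p^n}(R)$ its truncation to the $n+1$ components indexed by $1,p,\dots,p^n$, $F$ the Frobenius ($W(R)\to W(R)$ and $W_{p^n}(R)\to W_{p^{n-1}}(R)$), $V$ the Verschiebung, $[r]=(r,0,0,\dots)$. Put $I_0=R$, $I_i=\{r\in R : r^p\in pI_{i-1}\}$ for $i\ge1$ (these are ideals), $I_\infty=\bigcap_i I_i$, and $B(r,I)=r+I$. Then $F:W(R)\to W(R)$ is surjective. Moreover $R$ satisfies all of the following: 1. $F:W_{p^n}(R)\to W_{p^{n-1}}(R)$ is surjective for all $n\ge2$; in particular for $n=2$. 2. For every $x\in W(R)$ there is $r\in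 R$ with $x-[r]\in pW(R)$. 3. The image of $F:W(R)\to W(R)$ contains $[r]$ for all $r\in R$. 4. For all $n\ge 2$ the image of $F:W_{p^n}(R)\to W_{p^{n-1}}(R)$ contains all $(r,0,\dots,0)$, $r\in R$; in particular for $n=2$. 5. The image of $F:W(R)\to W(R)$ contains $V(1)$. 6. For all $n\ge2$ the image of $F:W_{p^n}(R)\to W_{p^{n-1}}(R)$ contains $V(1)$. 7. For all $n\ge2$ the image of $F:W_{p^n}(R)\to W_{p^{n-1}}(R)$ contains $V^{n-1}(1)$. 8. The image of $F:W_{p^2}(R)\to W_p(R)$ contains $V(1)$. 9. $F^n:W_{p^n}(R)\to W_1(R)$ is surjective for all $n\ge1$; in particular for $n=1$. 10. If $r_0,r_1,\dots\in R$ satisfy $B(r_0,I_0)\supseteq B(r_1,I_1)\supseteq\cdots$, then $\bigcap_{i\ge0}B(r_i,I_i)\neq\emptyset$. 11. The $p$-th power map on $R/pI_\infty$ is surjective. 12. For each $n\ge1$ the $p$-th power map on $R/pI_n$ is surjective; in particular for $n=1$. 13. For every $r\in R$ there is $s\in R$ with $s^p\equiv pr \pmod{p^2R}$. 14. There are $r,s\in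 R$ with $r^p\equiv -p\pmod{psR}$ and $s\in I_1$. 15. There are $r,s\in R$ with $r^p\equiv -p\pmod{psR}$ and $s^N\in pR$ for some integer $N>0$. 16. The Frobenius $\bar r\mapsto\bar r^p$ on $R/pR$ is surjective. Finally, $p$ is not invertible in $R$. -/

import Mathlib

/-! ### Finite-length Witt vectors and their Frobenius

The ring `W_{p^n}(R)`, with components indexed by `1, p, …, p^n`, is
`TruncatedWittVector p (n + 1) R`; the ring `W(R)` is `WittVector p R`. -/

namespace WittFrobenius

section Truncated

variable (p : ℕ) [hp : Fact p.Prime]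

theorem ker_truncate_le {R : Type*} [CommRing R] (n : ℕ) :
    RingHom.ker (WittVector.truncate (p := p) (R := R) (n + 1)) ≤
      RingHom.ker ((WittVector.truncate (p := p) (R := R) n).comp WittVector.frobenius) := by
  intro x hx
  rw [WittVector.mem_ker_truncate] at hx
  obtain ⟨y, rfl⟩ : ∃ y : WittVector p R, x = WittVector.verschiebung^[n + 1] y :=
    ⟨_, WittVector.eq_iterate_verschiebung hx⟩
  rw [RingHom.mem_ker, RingHom.comp_apply, Function.iterate_succ_apply',
    WittVector.frobenius_verschiebung, map_mul]
  have h : WittVector.verschiebung^[n] y ∈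
      RingHom.ker (WittVector.truncate (p := p) (R := R) n) := by
    rw [WittVector.mem_ker_truncate]
    intro i hi
    exact WittVector.iterate_verschiebung_coeff_eq_zero y hi
  rw [RingHom.mem_ker] at h
  rw [h, zero_mul]

/-- The Frobenius `F : W_{p^n}(R) → W_{p^{n-1}}(R)`: the ring homomorphism induced by the Frobenius
of `W(R)` on the truncations. -/
noncomputable def truncFrobenius (R : Type*) [CommRing R] (n : ℕ) :
    TruncatedWittVector p (n + 1) R →+* TruncatedWittVector p n R :=
  RingHom.liftOfSurjective (WittVector.truncate (p := p) (R := R) (n + 1))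
    (WittVector.truncate_surjective (p := p) (n + 1) R)
    ⟨(WittVector.truncate (p := p) (R := R) n).comp WittVector.frobenius, ker_truncate_le p n⟩

theorem truncFrobenius_truncate {R : Type*} [CommRing R] (n : ℕ) (x : WittVector p R) :
    truncFrobenius p R n (WittVector.truncate (n + 1) x) =
      WittVector.truncate n (WittVector.frobenius x) :=
  RingHom.liftOfRightInverse_comp_apply _ _ _ _ x

/-- The iterate `F^n : W_{p^n}(R) → W_1(R)`. -/
noncomputable def truncFrobeniusIter (R : Type*) [CommRing R] :
    (n : ℕ) → TruncatedWittVector p (n + 1) R →+* TruncatedWittVector p 1 R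
  | 0 => RingHom.id _
  | n + 1 => (truncFrobeniusIter R n).comp (truncFrobenius p R (n + 1))

end Truncated

/-! ### The ideals `I_i` and the balls -/

section Ideals

variable (p : ℕ) (R : Type*) [CommRing R]

/-- `I_0 = R` and `I_{i+1} = {r | r^p ∈ p I_i}`, as sets. -/
def frobSet : ℕ → Set R
  | 0 => Set.univ
  | i + 1 => {r | ∃ s ∈ frobSet i, r ^ p = (p : R) * s}

theorem frobSet_succ_subset (i : ℕ) : frobSet p R (i + 1) ⊆ frobSet p R i := by
  induction i with
  | zero => exact fun _ _ => trivial
  | succ i ih =>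
    rintro r ⟨s, hs, h⟩
    exact ⟨s, ih hs, h⟩

theorem frobSet_smul (i : ℕ) (c r : R) (h : r ∈ frobSet p R i) : c * r ∈ frobSet p R i := by
  induction i generalizing c r with
  | zero => trivial
  | succ i ih =>
    obtain ⟨s, hs, h⟩ := h
    exact ⟨c ^ p * s, ih _ _ hs, by rw [mul_pow, h]; ring⟩

variable [hp : Fact p.Prime]

theorem frobSet_add (i : ℕ) (x y : R) (hx : x ∈ frobSet p R i) (hy : y ∈ frobSet p R i) :
    x + y ∈ frobSet p R i := by
  induction i generalizing x y with
  | zero => trivial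
  | succ i ih =>
    have hx' := frobSet_succ_subset p R i hx
    obtain ⟨s, hs, h⟩ := hx
    obtain ⟨t, ht, h'⟩ := hy
    obtain ⟨r, hr⟩ := exists_add_pow_prime_eq hp.out x y
    refine ⟨s + t + (y * r) * x, ih _ _ (ih _ _ hs ht) (frobSet_smul p R i _ _ hx'), ?_⟩
    rw [hr, h, h']
    ring

theorem frobSet_zero_mem (i : ℕ) : (0 : R) ∈ frobSet p R i := by
  induction i with
  | zero => trivial
  | succ i ih => exact ⟨0, ih, by simp [hp.out.ne_zero]⟩

/-- The ideal `I_i` of `R`. -/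
def frobIdeal (i : ℕ) : Ideal R where
  carrier := frobSet p R i
  add_mem' := fun {x y} hx hy => frobSet_add p R i x y hx hy
  zero_mem' := frobSet_zero_mem p R i
  smul_mem' := fun c r h => frobSet_smul p R i c r h

/-- The ideal `I_∞`, the intersection of all the `I_i`. -/
def frobIdealInf : Ideal R := ⨅ i, frobIdeal p R i

/-- The ball `B(r, I) = r + I`. -/
def ball {R : Type*} [CommRing R] (r : R) (I : Ideal R) : Set R := {x | x - r ∈ I}

end Ideals

/-! ### The conditions on a ring `R` -/

section Conditions

variable (p : ℕ) [hp : Fact p.Prime] (R : Type*) [CommRing R]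

/-- `F : W(R) → W(R)` is surjective. -/
def FrobSurj : Prop :=
  Function.Surjective (WittVector.frobenius : WittVector p R →+* WittVector p R)

/-- `F : W_{p^n}(R) → W_{p^{n-1}}(R)` is surjective for all `n ≥ 2`. -/
def FrobSurjFinite : Prop :=
  ∀ n : ℕ, 2 ≤ n → Function.Surjective (truncFrobenius p R n)

/-- `F : W_{p^2}(R) → W_p(R)` is surjective. -/
def FrobSurjFiniteTwo : Prop :=
  Function.Surjective (truncFrobenius p R 2)

/-- Every element of `W(R)` is congruent to a Teichmüller element modulo `p W(R)`. -/
def TeichDense : Prop :=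
  ∀ x : WittVector p R, ∃ r : R, ∃ y : WittVector p R,
    x - WittVector.teichmuller p r = (p : WittVector p R) * y

/-- The image of `F : W(R) → W(R)` contains all Teichmüller elements. -/
def TeichInImage : Prop :=
  ∀ r : R, ∃ x : WittVector p R, WittVector.frobenius x = WittVector.teichmuller p r

/-- The image of `F : W_{p^n}(R) → W_{p^{n-1}}(R)` contains all `(r, 0, …, 0)`, for all `n ≥ 2`. -/
def TeichInImageFinite : Prop :=
  ∀ n : ℕ, 2 ≤ n → ∀ r : R, ∃ x : TruncatedWittVector p (n + 1) R,
    truncFrobenius p R n x = WittVector.truncate n (WittVector.teichmuller p r)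

/-- The image of `F : W_{p^2}(R) → W_p(R)` contains all `(r, 0)`. -/
def TeichInImageFiniteTwo : Prop :=
  ∀ r : R, ∃ x : TruncatedWittVector p 3 R,
    truncFrobenius p R 2 x = WittVector.truncate 2 (WittVector.teichmuller p r)

/-- The image of `F : W(R) → W(R)` contains `V(1)`. -/
def VOneInImage : Prop :=
  ∃ x : WittVector p R, WittVector.frobenius x = WittVector.verschiebung 1

/-- For all `n ≥ 2`, the image of `F : W_{p^n}(R) → W_{p^{n-1}}(R)` contains `V(1)`. -/
def VOneInImageFinite : Prop :=
  ∀ n : ℕ, 2 ≤ n → ∃ x : TruncatedWittVector p (n + 1) R,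
    truncFrobenius p R n x = WittVector.truncate n (WittVector.verschiebung 1)

/-- For all `n ≥ 2`, the image of `F : W_{p^n}(R) → W_{p^{n-1}}(R)` contains `V^{n-1}(1)`. -/
def VPowOneInImageFinite : Prop :=
  ∀ n : ℕ, 2 ≤ n → ∃ x : TruncatedWittVector p (n + 1) R,
    truncFrobenius p R n x = WittVector.truncate n (WittVector.verschiebung^[n - 1] 1)

/-- The image of `F : W_{p^2}(R) → W_p(R)` contains `V(1)`. -/
def VOneInImageFiniteTwo : Prop :=
  ∃ x : TruncatedWittVector p 3 R,
    truncFrobenius p R 2 x = WittVector.truncate 2 (WittVector.verschiebung 1)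

/-- `F^n : W_{p^n}(R) → W_1(R)` is surjective for all `n ≥ 1`. -/
def FrobIterSurj : Prop :=
  ∀ n : ℕ, 1 ≤ n → Function.Surjective (truncFrobeniusIter p R n)

/-- `F : W_p(R) → W_1(R)` is surjective. -/
def FrobIterSurjOne : Prop :=
  Function.Surjective (truncFrobenius p R 1)

/-- `R` contains `p⁻¹`. -/
def PInvertible : Prop := IsUnit (p : R)

/-- Every decreasing sequence of balls `B(r_0, I_0) ⊇ B(r_1, I_1) ⊇ ⋯` has nonempty
intersection. -/
def BallsIntersect : Prop :=
  ∀ r : ℕ → R,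
    (∀ i, ball (r (i + 1)) (frobIdeal p R (i + 1)) ⊆ ball (r i) (frobIdeal p R i)) →
    (⋂ i, ball (r i) (frobIdeal p R i)).Nonempty

/-- The `p`-th power map on `R / p I_∞` is surjective. -/
def PthRootsInf : Prop :=
  Function.Surjective (fun x : R ⧸ (Ideal.span {(p : R)} * frobIdealInf p R) => x ^ p)

/-- For all `n ≥ 1`, the `p`-th power map on `R / p I_n` is surjective. -/
def PthRootsFinite : Prop :=
  ∀ n : ℕ, 1 ≤ n →
    Function.Surjective (fun x : R ⧸ (Ideal.span {(p : R)} * frobIdeal p R n) => x ^ p)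

/-- The `p`-th power map on `R / p I_1` is surjective. -/
def PthRootsFiniteOne : Prop :=
  Function.Surjective (fun x : R ⧸ (Ideal.span {(p : R)} * frobIdeal p R 1) => x ^ p)

/-- For every `r` there is `s` with `s^p ≡ p r` modulo `p^2 R`. -/
def PthRootsPMul : Prop :=
  ∀ r : R, ∃ s : R, (p : R) ^ 2 ∣ s ^ p - (p : R) * r

/-- There are `r, s` with `r^p ≡ -p` modulo `p s R` and `s ∈ I_1`. -/
def PthRootNegP : Prop :=
  ∃ r s : R, (p : R) * s ∣ r ^ p - (-(p : R)) ∧ s ∈ frobIdeal p R 1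

/-- There are `r, s` with `r^p ≡ -p` modulo `p s R` and `s^N ∈ p R` for some `N > 0`. -/
def PthRootNegPWeak : Prop :=
  ∃ r s : R, (p : R) * s ∣ r ^ p - (-(p : R)) ∧ ∃ N : ℕ, 0 < N ∧ (p : R) ∣ s ^ N

/-- The `p`-th power Frobenius on `R / p R` is surjective. -/
def PthRootsModP : Prop :=
  Function.Surjective (fun x : R ⧸ Ideal.span {(p : R)} => x ^ p)

/-- All of the conditions above, except for surjectivity of `F` on `W(R)` and invertibility
of `p`. -/
structure OtherConditions : Prop where
  frobSurjFinite : FrobSurjFinite p R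
  frobSurjFiniteTwo : FrobSurjFiniteTwo p R
  teichDense : TeichDense p R
  teichInImage : TeichInImage p R
  teichInImageFinite : TeichInImageFinite p R
  teichInImageFiniteTwo : TeichInImageFiniteTwo p R
  vOneInImage : VOneInImage p R
  vOneInImageFinite : VOneInImageFinite p R
  vPowOneInImageFinite : VPowOneInImageFinite p R
  vOneInImageFiniteTwo : VOneInImageFiniteTwo p R
  frobIterSurj : FrobIterSurj p R
  frobIterSurjOne : FrobIterSurjOne p R
  ballsIntersect : BallsIntersect p R
  pthRootsInf : PthRootsInf p R
  pthRootsFinite : PthRootsFinite p R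
  pthRootsFiniteOne : PthRootsFiniteOne p R
  pthRootsPMul : PthRootsPMul p R
  pthRootNegP : PthRootNegP p R
  pthRootNegPWeak : PthRootNegPWeak p R
  pthRootsModP : PthRootsModP p R

end Conditions

/-! ### Poonen's ring -/

/-- The ring `A⟦t^ℚ⟧` of generalized power series: formal sums `∑ c_i t^i` over rational `i ≥ 0`
with well-ordered support. -/
abbrev GenPowerSeries (A : Type*) [CommRing A] : Type _ := HahnSeries ℚ≥0 A

/-- The ring `A⟦t^ℚ⟧ / (t - p)`. -/
abbrev PoonenRing (p : ℕ) (A : Type*) [CommRing A] : Type _ :=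
  GenPowerSeries A ⧸
    Ideal.span {(HahnSeries.single (1 : ℚ≥0) (1 : A) - (p : GenPowerSeries A))}

end WittFrobenius

/-!
Write `B = A⟦t^ℚ⟧` and `R = B / (t - p)`, and let `σ` be a bijective lift of the Frobenius of
`A / p`. Then `φ (∑ c_i t^i) = ∑ σ(c_i) t^{pi}` is a bijective lift of the Frobenius of `B / p`, so
by Dwork's lemma there is a ring homomorphism `B → W(B) → W(R)` that carries `φ` to `F`. As
`F (V x) = p x`, the surjectivity of `F` follows once `B → W(R) / p` is surjective. For the latter,
one corrects the Witt components one at a time: since `φ (t^i) = (t^i)^p`, the element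
`t^{1 + 1/p + ⋯ + 1/p^{n-1}}` of `B` goes to a product of Teichmüller elements, which modulo `p` is
`V^n` of a unit, so a suitable multiple of it corrects the `n`-th component without disturbing the
earlier ones. The corrections can be summed in `B` because their exponents increase: below each
exponent only finitely many of them contribute, so the support of the sum is well-ordered.
-/

namespace WittFrobenius

open WittVector

theorem exists_seq_of_forall_exists_next {α : Type*} {P : ℕ → α → Prop} {r : ℕ → α → α → Prop}
    (zero : ∃ x, P 0 x) (next : ∀ n x, P n x → ∃ y, P (n + 1) y ∧ r n x y) :
    ∃ x : ℕ → α, ∀ n, P n (x n) ∧ r n (x n) (x (n + 1)) := by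
  choose! f hP hr using next
  obtain ⟨a, ha⟩ := zero
  let x : ℕ → α := Nat.rec a f
  have hx : ∀ n, P n (x n) := Nat.rec ha fun n => hP n (x n)
  exact ⟨x, fun n => ⟨hx n, hr n (x n) (hx n)⟩⟩

section Truncation

variable {p : ℕ} [Fact p.Prime] {R : Type*} [CommRing R] {x y : WittVector p R} {n : ℕ}

theorem truncate_eq_zero_iff : truncate n x = 0 ↔ ∀ i < n, x.coeff i = 0 :=
  mem_ker_truncate n x

theorem truncate_eq_iff : truncate n x = truncate n y ↔ ∀ i < n, x.coeff i = y.coeff i := by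
  simp only [TruncatedWittVector.ext_iff, coeff_truncate, Fin.forall_iff]

theorem truncate_eq_of_le {m : ℕ} (hmn : m ≤ n) (h : truncate n x = truncate n y) :
    truncate m x = truncate m y :=
  truncate_eq_iff.2 fun i hi => truncate_eq_iff.1 h i (hi.trans_le hmn)

theorem truncate_iterate_verschiebung (n : ℕ) (x : WittVector p R) :
    truncate n (verschiebung^[n] x) = 0 :=
  truncate_eq_zero_iff.2 fun _ hi => iterate_verschiebung_coeff_eq_zero x hi

theorem truncate_succ_iterate_verschiebung_eq_zero_iff :
    truncate (n + 1) (verschiebung^[n] x) = 0 ↔ x.coeff 0 = 0 := by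
  have hcoeff : (verschiebung^[n] x).coeff n = x.coeff 0 := by
    simpa only [zero_add] using iterate_verschiebung_coeff x n 0
  rw [truncate_eq_zero_iff, Nat.forall_lt_succ_right, hcoeff]
  exact and_iff_right fun _ hi => iterate_verschiebung_coeff_eq_zero x hi

theorem eq_of_forall_truncate_eq (h : ∀ n, truncate n x = truncate n y) : x = y := by
  ext i
  exact truncate_eq_iff.1 (h (i + 1)) i i.lt_succ_self

theorem exists_forall_truncate_eq {x : ℕ → WittVector p R}
    (h : ∀ n, truncate n (x (n + 1)) = truncate n (x n)) :
    ∃ y, ∀ n, truncate n y = truncate n (x n) := by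
  have hle : ∀ m n, m ≤ n → truncate m (x n) = truncate m (x m) := fun m n hmn =>
    Nat.le_induction rfl (fun k hk ih => (truncate_eq_of_le hk (h k)).trans ih) n hmn
  refine ⟨WittVector.mk p fun i => (x (i + 1)).coeff i, fun n => truncate_eq_iff.2 fun i hi => ?_⟩
  rw [coeff_mk]
  exact (truncate_eq_iff.1 (hle _ _ (Nat.succ_le_of_lt hi)) i i.lt_succ_self).symm

theorem natCast_dvd_truncate_iff : (p : TruncatedWittVector p n R) ∣ truncate n x ↔
    ∃ z w : WittVector p R, x = verschiebung^[n] z + p * w := by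
  constructor
  · rintro ⟨w, hw⟩
    obtain ⟨w, rfl⟩ := truncate_surjective p n R w
    have hker : truncate n (x - (p : WittVector p R) * w) = 0 := by
      rw [map_sub, hw, map_mul, map_natCast, sub_self]
    exact ⟨_, w, sub_eq_iff_eq_add.1 (eq_iterate_verschiebung (truncate_eq_zero_iff.1 hker))⟩
  · rintro ⟨z, w, rfl⟩
    rw [map_add, truncate_iterate_verschiebung, zero_add, map_mul, map_natCast]
    exact dvd_mul_right _ _

end Truncation

section Ghost

variable {p : ℕ} [Fact p.Prime] {R : Type*} [CommRing R] {x y : WittVector p R} {n : ℕ}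

theorem ghostComponent_eq_sum (n : ℕ) (x : WittVector p R) :
    ghostComponent n x = ∑ i ∈ Finset.range (n + 1), (p : R) ^ i * x.coeff i ^ p ^ (n - i) := by
  rw [ghostComponent_apply, aeval_wittPolynomial]

theorem ghostComponent_zero_eq_coeff (x : WittVector p R) : ghostComponent 0 x = x.coeff 0 := by
  simp [ghostComponent_eq_sum]

theorem ghostComponent_iterate_verschiebung_of_lt {i : ℕ} (hi : i < n) (x : WittVector p R) :
    ghostComponent i (verschiebung^[n] x) = 0 := by
  rw [ghostComponent_eq_sum]
  refine Finset.sum_eq_zero fun j hj => ?_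
  rw [iterate_verschiebung_coeff_eq_zero x ((Finset.mem_range_succ_iff.1 hj).trans_lt hi),
    zero_pow (pow_ne_zero _ (Fact.out : p.Prime).ne_zero), mul_zero]

theorem ghostComponent_iterate_verschiebung_self (n : ℕ) (x : WittVector p R) :
    ghostComponent n (verschiebung^[n] x) = (p : R) ^ n * x.coeff 0 := by
  induction n with
  | zero => simpa using ghostComponent_zero_eq_coeff x
  | succ n ih => rw [Function.iterate_succ_apply', ghostComponent_verschiebung, ih]; ring

theorem coeff_zero_frobenius (x : WittVector p R) :
    (frobenius x).coeff 0 = x.coeff 0 ^ p + p * x.coeff 1 := by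
  rw [← ghostComponent_zero_eq_coeff, ghostComponent_frobenius, ghostComponent_eq_sum]
  simp [Finset.sum_range_succ]

theorem ghostComponent_eq_of_truncate_eq (h : truncate n x = truncate n y) {i : ℕ} (hi : i < n) :
    ghostComponent i x = ghostComponent i y := by
  rw [ghostComponent_eq_sum, ghostComponent_eq_sum]
  refine Finset.sum_congr rfl fun j hj => ?_
  rw [truncate_eq_iff.1 h j ((Finset.mem_range_succ_iff.1 hj).trans_lt hi)]

theorem truncate_eq_of_ghostComponent_eq (hp : IsLeftRegular (p : R))
    (h : ∀ i < n, ghostComponent i x = ghostComponent i y) : truncate n x = truncate n y := by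
  rw [truncate_eq_iff]
  intro i
  induction i using Nat.strong_induction_on with
  | _ i ih =>
    intro hi
    have hlower : ∑ j ∈ Finset.range i, (p : R) ^ j * x.coeff j ^ p ^ (i - j) =
        ∑ j ∈ Finset.range i, (p : R) ^ j * y.coeff j ^ p ^ (i - j) :=
      Finset.sum_congr rfl fun j hj => by
        rw [ih j (Finset.mem_range.1 hj) ((Finset.mem_range.1 hj).trans hi)]
    have hghost := h i hi
    rw [ghostComponent_eq_sum, ghostComponent_eq_sum, Finset.sum_range_succ,
      Finset.sum_range_succ, hlower] at hghost
    simpa using hp.pow i (add_left_cancel hghost)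

theorem eq_of_ghostComponent_eq (hp : IsLeftRegular (p : R))
    (h : ∀ n, ghostComponent n x = ghostComponent n y) : x = y :=
  eq_of_forall_truncate_eq fun _ => truncate_eq_of_ghostComponent_eq hp fun i _ => h i

theorem truncate_natCast_mul_cancel (hp : IsLeftRegular (p : R))
    (h : truncate n ((p : WittVector p R) * x) = truncate n ((p : WittVector p R) * y)) :
    truncate n x = truncate n y :=
  truncate_eq_of_ghostComponent_eq hp fun i hi => hp <| by
    simpa using ghostComponent_eq_of_truncate_eq h hi

theorem natCast_dvd_of_forall_natCast_dvd_truncate (hp : IsLeftRegular (p : R))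
    (h : ∀ n, (p : TruncatedWittVector p n R) ∣ truncate n x) : (p : WittVector p R) ∣ x := by
  choose z w hzw using fun n => natCast_dvd_truncate_iff.1 (h n)
  have hw : ∀ n, truncate n x = truncate n ((p : WittVector p R) * w n) := fun n => by
    conv_lhs => rw [hzw n, map_add, truncate_iterate_verschiebung, zero_add]
  obtain ⟨v, hv⟩ := exists_forall_truncate_eq (x := w) fun n => truncate_natCast_mul_cancel hp <|
    (truncate_eq_of_le n.le_succ (hw (n + 1))).symm.trans (hw n)
  refine ⟨v, eq_of_forall_truncate_eq fun n => ?_⟩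
  rw [hw, map_mul, map_mul, hv]

end Ghost

section FrobeniusLift

variable {B : Type*} [CommRing B] {p : ℕ} {φ : B →+* B}

/-- `φ` is a lift to `B` of the Frobenius endomorphism of `B / pB`. -/
def IsFrobeniusLift (p : ℕ) (φ : B →+* B) : Prop :=
  ∀ b, (p : B) ∣ φ b - b ^ p

variable [Fact p.Prime]

theorem IsFrobeniusLift.pow_succ_dvd_map_ghostComponent_sub (hφ : IsFrobeniusLift p φ)
    (x : WittVector p B) (n : ℕ) :
    (p : B) ^ (n + 1) ∣ φ (ghostComponent n x) - ghostComponent (n + 1) x := by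
  rw [ghostComponent_eq_sum, ghostComponent_eq_sum, Finset.sum_range_succ _ (n + 1),
    ← sub_sub, map_sum, ← Finset.sum_sub_distrib]
  refine dvd_sub (Finset.dvd_sum fun i hi => ?_) (dvd_mul_right _ _)
  have hin : i ≤ n := Finset.mem_range_succ_iff.1 hi
  have hpow := mul_dvd_mul_left ((p : B) ^ i) (dvd_sub_pow_of_dvd_sub (hφ (x.coeff i)) (n - i))
  rw [← pow_add, ← add_assoc, Nat.add_sub_cancel' hin, ← pow_mul, ← pow_succ',
    ← Nat.sub_add_comm hin, mul_sub] at hpow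
  simpa only [map_mul, map_pow, map_natCast] using hpow

/-- Dwork's lemma. -/
theorem IsFrobeniusLift.exists_ghostComponent_eq (hφ : IsFrobeniusLift p φ) (g : ℕ → B)
    (hg : ∀ n, (p : B) ^ (n + 1) ∣ φ (g n) - g (n + 1)) :
    ∃ x : WittVector p B, ∀ n, ghostComponent n x = g n := by
  have hnext : ∀ n (x : WittVector p B), (∀ i < n, ghostComponent i x = g i) →
      ∃ y : WittVector p B, (∀ i < n + 1, ghostComponent i y = g i) ∧
        truncate n y = truncate n x := by
    intro n x hx
    have hdvd : (p : B) ^ n ∣ g n - ghostComponent n x := by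
      cases n with
      | zero => simp
      | succ n =>
        have hx' := hφ.pow_succ_dvd_map_ghostComponent_sub x n
        rw [hx n n.lt_succ_self] at hx'
        simpa using dvd_sub hx' (hg n)
    obtain ⟨v, hv⟩ := hdvd
    refine ⟨x + verschiebung^[n] (teichmuller p v), fun i hi => ?_, ?_⟩
    · rw [map_add]
      rcases Nat.lt_succ_iff_lt_or_eq.1 hi with hi | rfl
      · rw [ghostComponent_iterate_verschiebung_of_lt hi, add_zero, hx i hi]
      · rw [ghostComponent_iterate_verschiebung_self, teichmuller_coeff_zero, ← hv,
          add_sub_cancel]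
    · rw [map_add, truncate_iterate_verschiebung, add_zero]
  obtain ⟨x, hx⟩ := exists_seq_of_forall_exists_next
    ⟨0, fun i hi => absurd hi i.not_lt_zero⟩ hnext
  obtain ⟨y, hy⟩ := exists_forall_truncate_eq fun n => (hx n).2
  exact ⟨y, fun n => (ghostComponent_eq_of_truncate_eq (hy (n + 1)) n.lt_succ_self).trans
    ((hx (n + 1)).1 n n.lt_succ_self)⟩

theorem IsFrobeniusLift.exists_ghostComponent_eq_iterate (hφ : IsFrobeniusLift p φ) (b : B) :
    ∃ x : WittVector p B, ∀ n, ghostComponent n x = φ^[n] b :=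
  hφ.exists_ghostComponent_eq _ fun n => by simp [Function.iterate_succ_apply']

variable (hφ : IsFrobeniusLift p φ) (hB : IsLeftRegular (p : B))

/-- The section `B → W(B)` of the projection to the first component attached to a Frobenius lift
`φ` on a `p`-torsion-free ring; the ghost components of the image of `b` are `b, φ b, φ² b, …`. -/
noncomputable def wittLift : B →+* WittVector p B where
  toFun b := (hφ.exists_ghostComponent_eq_iterate b).choose
  map_one' := eq_of_ghostComponent_eq hB fun n => by
    rw [Exists.choose_spec (hφ.exists_ghostComponent_eq_iterate 1), iterate_map_one, map_one]
  map_mul' a b := eq_of_ghostComponent_eq hB fun n => by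
    rw [map_mul, Exists.choose_spec (hφ.exists_ghostComponent_eq_iterate a),
      Exists.choose_spec (hφ.exists_ghostComponent_eq_iterate b),
      Exists.choose_spec (hφ.exists_ghostComponent_eq_iterate (a * b)), iterate_map_mul]
  map_zero' := eq_of_ghostComponent_eq hB fun n => by
    rw [Exists.choose_spec (hφ.exists_ghostComponent_eq_iterate 0), iterate_map_zero, map_zero]
  map_add' a b := eq_of_ghostComponent_eq hB fun n => by
    rw [map_add, Exists.choose_spec (hφ.exists_ghostComponent_eq_iterate a),
      Exists.choose_spec (hφ.exists_ghostComponent_eq_iterate b),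
      Exists.choose_spec (hφ.exists_ghostComponent_eq_iterate (a + b)), iterate_map_add]

theorem ghostComponent_wittLift (n : ℕ) (b : B) :
    ghostComponent n (wittLift hφ hB b) = φ^[n] b :=
  (hφ.exists_ghostComponent_eq_iterate b).choose_spec n

theorem coeff_zero_wittLift (b : B) : (wittLift hφ hB b).coeff 0 = b := by
  rw [← ghostComponent_zero_eq_coeff, ghostComponent_wittLift, Function.iterate_zero_apply]

theorem frobenius_wittLift (b : B) : frobenius (wittLift hφ hB b) = wittLift hφ hB (φ b) :=
  eq_of_ghostComponent_eq hB fun n => by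
    rw [ghostComponent_frobenius, ghostComponent_wittLift, ghostComponent_wittLift,
      Function.iterate_succ_apply]

theorem wittLift_eq_teichmuller {b : B} (hb : φ b = b ^ p) :
    wittLift hφ hB b = teichmuller p b :=
  eq_of_ghostComponent_eq hB fun n => by
    have hiter : φ^[n] b = b ^ p ^ n := by
      induction n with
      | zero => simp
      | succ n ih => rw [Function.iterate_succ_apply', ih, map_pow, hb, ← pow_mul, ← pow_succ']
    rw [ghostComponent_wittLift, ghostComponent_teichmuller, hiter]

end FrobeniusLift

section Teichmuller

variable {p : ℕ} [Fact p.Prime] {R : Type*} [CommRing R]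

theorem map_frobenius {S : Type*} [CommRing S] (f : R →+* S) (x : WittVector p R) :
    WittVector.map f (frobenius x) = frobenius (WittVector.map f x) :=
  WittVector.ext fun n => by
    simp_rw [map_coeff, coeff_frobenius, MvPolynomial.map_aeval, funext (map_coeff f _),
      RingHom.ext_int _ (algebraMap ℤ S), MvPolynomial.aeval_eq_eval₂Hom]

theorem frobenius_teichmuller (r : R) :
    frobenius (teichmuller p r) = teichmuller p (r ^ p) := by
  have hX : frobenius (teichmuller p (Polynomial.X : Polynomial ℤ)) =
      teichmuller p (Polynomial.X ^ p) := by
    refine eq_of_ghostComponent_eq (IsRegular.of_ne_zero ?_).left fun n => ?_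
    · exact_mod_cast (Fact.out : p.Prime).ne_zero
    · rw [ghostComponent_frobenius, ghostComponent_teichmuller, ghostComponent_teichmuller,
        ← pow_mul, pow_succ']
  simpa [map_frobenius, map_teichmuller] using
    congrArg (WittVector.map (Polynomial.aeval r).toRingHom) hX

theorem iterate_frobenius_teichmuller (n : ℕ) (r : R) :
    frobenius^[n] (teichmuller p r) = teichmuller p (r ^ p ^ n) := by
  induction n with
  | zero => simp
  | succ n ih => rw [Function.iterate_succ_apply', ih, frobenius_teichmuller, ← pow_mul, pow_succ]

theorem exists_eq_teichmuller_add_verschiebung (x : WittVector p R) :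
    ∃ y, x = teichmuller p (x.coeff 0) + verschiebung y := by
  have h : ∀ i < 1, (x - teichmuller p (x.coeff 0)).coeff i = 0 := fun i hi => by
    obtain rfl : i = 0 := by omega
    simpa [constantCoeff_apply, sub_eq_zero] using
      map_sub constantCoeff x (teichmuller p (x.coeff 0))
  exact ⟨_, sub_eq_iff_eq_add'.1 (eq_iterate_verschiebung h)⟩

end Teichmuller

section PseudoLimits

variable {R : Type*} [CommRing R] {τ : ℕ → R}

/-- Every sequence whose consecutive differences are divisible by `τ 0, τ 1, …` has a
pseudo-limit, an element congruent to its `n`-th term modulo `τ n` for every `n`. If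
`τ n ∣ τ (n + 1)` for all `n`, this says that nested sequences of balls `b n + (τ n)` have
nonempty intersection. -/
def HasPseudoLimits (τ : ℕ → R) : Prop :=
  ∀ b : ℕ → R, (∀ n, τ n ∣ b (n + 1) - b n) → ∃ c, ∀ n, τ n ∣ c - b n

theorem HasPseudoLimits.map {S : Type*} [CommRing S] (hτ : HasPseudoLimits τ) {π : R →+* S}
    (hπ : Function.Surjective π) : HasPseudoLimits fun n => π (τ n) := by
  intro r hr
  obtain ⟨b, hb⟩ := exists_seq_of_forall_exists_next (P := fun n b => π b = r n)
    (r := fun n b b' => τ n ∣ b' - b) (hπ (r 0)) fun n b hb => by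
      obtain ⟨d, hd⟩ := hr n
      obtain ⟨e, rfl⟩ := hπ d
      exact ⟨b + τ n * e, by rw [map_add, map_mul, hb, ← hd, add_sub_cancel],
        by rw [add_sub_cancel_left]; exact dvd_mul_right _ _⟩
  obtain ⟨c, hc⟩ := hτ b fun n => (hb n).2
  exact ⟨π c, fun n => by simpa only [map_sub, (hb n).1] using map_dvd π (hc n)⟩

end PseudoLimits

section RootTower

variable {p : ℕ} {R : Type*} [CommRing R] {ϖ : ℕ → R}

/-- `ϖ` is a compatible system of `p`-power roots of `p`, so that `ϖ n` is a `p ^ n`-th root. -/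
structure IsRootTower (p : ℕ) (ϖ : ℕ → R) : Prop where
  zero : ϖ 0 = p
  succ_pow : ∀ n, ϖ (n + 1) ^ p = ϖ n

namespace IsRootTower

variable (hϖ : IsRootTower p ϖ)
include hϖ

theorem pow_pow_eq (n : ℕ) : ϖ n ^ p ^ n = p := by
  induction n with
  | zero => simpa using hϖ.zero
  | succ n ih => rw [pow_succ', pow_mul, hϖ.succ_pow, ih]

theorem prod_pow (n : ℕ) :
    (∏ m ∈ Finset.range n, ϖ (m + 1)) ^ p = ∏ m ∈ Finset.range n, ϖ m := by
  rw [← Finset.prod_pow]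
  exact Finset.prod_congr rfl fun m _ => hϖ.succ_pow m

theorem prod_succ_pow (n : ℕ) : (∏ m ∈ Finset.range (n + 1), ϖ (m + 1)) ^ p =
    p * ∏ m ∈ Finset.range n, ϖ (m + 1) := by
  rw [hϖ.prod_pow, Finset.prod_range_succ', hϖ.zero, mul_comm]

variable [Fact p.Prime]

theorem dvd_natCast (n : ℕ) : ϖ n ∣ p :=
  hϖ.pow_pow_eq n ▸ dvd_pow_self _ (pow_ne_zero _ (Fact.out : p.Prime).ne_zero)

theorem isLeftRegular (hp : IsLeftRegular (p : R)) (n : ℕ) : IsLeftRegular (ϖ n) := by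
  rwa [← hϖ.pow_pow_eq n, IsLeftRegular.pow_iff (pow_pos (Fact.out : p.Prime).pos n)] at hp

end IsRootTower

end RootTower

section FrobeniusSurjective

variable {p : ℕ} [Fact p.Prime] {R : Type*} [CommRing R]

theorem exists_teichmuller_natCast_eq (hp : IsLeftRegular (p : R)) :
    ∃ u : WittVector p R, (p : R) ∣ u.coeff 0 + 1 ∧
      teichmuller p (p : R) = verschiebung u + p := by
  obtain ⟨y, hy⟩ := exists_eq_teichmuller_add_verschiebung (p : WittVector p R)
  rw [← constantCoeff_apply, map_natCast] at hy
  have hghost := congrArg (ghostComponent 1) hy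
  rw [map_natCast, map_add, ghostComponent_teichmuller, ghostComponent_verschiebung,
    ghostComponent_zero_eq_coeff, pow_one] at hghost
  have hneg : (-y).coeff 0 = -y.coeff 0 := map_neg constantCoeff y
  have hpow : (p : R) ^ p = p * p ^ (p - 1) := by
    rw [← pow_succ', Nat.sub_add_cancel (Fact.out : p.Prime).one_le]
  have hcoeff : (-y).coeff 0 + 1 = (p : R) ^ (p - 1) := hp <| by
    simp only [hneg]
    linear_combination hghost + hpow
  exact ⟨-y, hcoeff ▸ dvd_pow_self _ (Nat.sub_ne_zero_of_lt (Fact.out : p.Prime).one_lt),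
    by rw [map_neg]; linear_combination -hy⟩

theorem natCast_dvd_truncate_succ_sub (n : ℕ) {u z e : WittVector p R}
    (h : u.coeff 0 * (frobenius^[n] e).coeff 0 = z.coeff 0) (v w : WittVector p R) :
    (p : TruncatedWittVector p (n + 1) R) ∣ truncate (n + 1)
      (verschiebung^[n] z + p * w - (verschiebung^[n] u + p * v) * e) := by
  have hzero : truncate (n + 1) (verschiebung^[n] (z - u * frobenius^[n] e)) = 0 := by
    rw [truncate_succ_iterate_verschiebung_eq_zero_iff, ← constantCoeff_apply, map_sub, map_mul]
    exact sub_eq_zero.2 h.symm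
  have hsplit : verschiebung^[n] z + p * w - (verschiebung^[n] u + p * v) * e =
      verschiebung^[n] (z - u * frobenius^[n] e) + p * (w - v * e) := by
    rw [iterate_map_sub, ← iterate_verschiebung_mul_left]
    ring
  rw [hsplit, map_add, hzero, zero_add, map_mul, map_natCast]
  exact dvd_mul_right _ _

theorem isUnit_add_mul_of_mem_jacobson {a : R} (ha : a ∈ Ideal.jacobson (⊥ : Ideal R)) {u : R}
    (hu : IsUnit u) (b : R) : IsUnit (u + a * b) := by
  obtain ⟨u, rfl⟩ := hu
  have h := (Ideal.mem_jacobson_bot.1 ha (b * ↑u⁻¹)).mul u.isUnit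
  rwa [add_mul, one_mul, mul_assoc, mul_assoc, Units.inv_mul, mul_one, add_comm] at h

variable (hp : IsLeftRegular (p : R))
include hp

theorem frobenius_surjective_of_lift {B : Type*} [CommRing B] {φ : B → B}
    (hφ : Function.Surjective φ) {s : B →+* WittVector p R}
    (hs : ∀ b, frobenius (s b) = s (φ b)) (hs₀ : Function.Surjective fun b => (s b).coeff 0)
    {τ : ℕ → B} (hτ : HasPseudoLimits τ)
    (hsτ : ∀ n, ∃ u w : WittVector p R, IsUnit (u.coeff 0) ∧
      s (τ n) = verschiebung^[n] u + p * w) :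
    FrobSurj p R := by
  intro y
  have hsφ : ∀ n b, frobenius^[n] (s b) = s (φ^[n] b) := fun n b =>
    ((Function.Semiconj.iterate_right (f := s) (fun b => (hs b).symm) n) b).symm
  have hnext : ∀ n b, (p : TruncatedWittVector p n R) ∣ truncate n (y - s b) →
      ∃ b', (p : TruncatedWittVector p (n + 1) R) ∣ truncate (n + 1) (y - s b') ∧
        τ n ∣ b' - b := by
    intro n b hb
    obtain ⟨z, w, hzw⟩ := natCast_dvd_truncate_iff.1 hb
    obtain ⟨u, v, hu, huv⟩ := hsτ n
    obtain ⟨a, ha⟩ := hu.exists_right_inv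
    obtain ⟨d, hd⟩ := hs₀ (a * z.coeff 0)
    obtain ⟨e, rfl⟩ := hφ.iterate n d
    have hcoeff : u.coeff 0 * (frobenius^[n] (s e)).coeff 0 = z.coeff 0 := by
      rw [hsφ]
      linear_combination u.coeff 0 * hd + z.coeff 0 * ha
    refine ⟨b + τ n * e, ?_, by rw [add_sub_cancel_left]; exact dvd_mul_right _ _⟩
    rw [map_add, map_mul, ← sub_sub, hzw, huv]
    exact natCast_dvd_truncate_succ_sub n hcoeff v w
  obtain ⟨b, hb⟩ := exists_seq_of_forall_exists_next (P := fun n b =>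
    (p : TruncatedWittVector p n R) ∣ truncate n (y - s b))
    ⟨0, natCast_dvd_truncate_iff.2 ⟨y - s 0, 0, by simp⟩⟩ hnext
  obtain ⟨c, hc⟩ := hτ b fun n => (hb n).2
  have hyc : (p : WittVector p R) ∣ y - s c :=
    natCast_dvd_of_forall_natCast_dvd_truncate hp fun n => by
      obtain ⟨k, hk⟩ := hc n
      obtain ⟨u, v, -, huv⟩ := hsτ n
      have hsτn : (p : TruncatedWittVector p n R) ∣ truncate n (s (τ n)) :=
        natCast_dvd_truncate_iff.2 ⟨u, v, huv⟩
      rw [← sub_sub_sub_cancel_right y (s c) (s (b n)), ← map_sub, hk, map_sub, map_mul, map_mul]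
      exact dvd_sub (hb n).1 (hsτn.mul_right _)
  obtain ⟨z, hz⟩ := hyc
  obtain ⟨d, rfl⟩ := hφ c
  refine ⟨s d + verschiebung z, ?_⟩
  rw [map_add, hs, frobenius_verschiebung, mul_comm, ← hz, add_sub_cancel]

variable (hJ : (p : R) ∈ Ideal.jacobson (⊥ : Ideal R))
include hJ

theorem IsRootTower.exists_teichmuller_prod_eq {ϖ : ℕ → R} (hϖ : IsRootTower p ϖ) (n : ℕ) :
    ∃ u w : WittVector p R, IsUnit (u.coeff 0) ∧
      teichmuller p (∏ m ∈ Finset.range n, ϖ m) = verschiebung^[n] u + p * w := by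
  obtain ⟨v, hv, hpv⟩ := exists_teichmuller_natCast_eq hp
  have hvunit : IsUnit (v.coeff 0) := by
    obtain ⟨d, hd⟩ := hv
    rw [show v.coeff 0 = -1 + p * d by rw [← hd]; ring]
    exact isUnit_add_mul_of_mem_jacobson hJ isUnit_one.neg d
  induction n with
  | zero => exact ⟨1, 0, by simp⟩
  | succ n ih =>
    obtain ⟨u, w, hu, huw⟩ := ih
    have hshift : verschiebung^[n] u * teichmuller p (ϖ n) =
        verschiebung^[n + 1] (v * frobenius u) + p * verschiebung^[n] u := by
      rw [iterate_verschiebung_mul_left, iterate_frobenius_teichmuller, hϖ.pow_pow_eq, hpv, mul_add,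
        mul_comm u, ← verschiebung_mul_frobenius, iterate_map_add, Function.iterate_succ_apply,
        mul_comm u, ← nsmul_eq_mul, iterate_map_nsmul, nsmul_eq_mul]
    refine ⟨v * frobenius u, verschiebung^[n] u + w * teichmuller p (ϖ n), ?_, ?_⟩
    · rw [mul_coeff_zero, coeff_zero_frobenius]
      exact hvunit.mul (isUnit_add_mul_of_mem_jacobson hJ (hu.pow p) _)
    · rw [Finset.prod_range_succ, map_mul, huw, add_mul, hshift]
      ring

theorem IsFrobeniusLift.frobSurj {B : Type*} [CommRing B] {φ : B →+* B}
    (hφ : IsFrobeniusLift p φ) (hB : IsLeftRegular (p : B)) (hφs : Function.Surjective φ)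
    {π : B →+* R} (hπ : Function.Surjective π) {θ : ℕ → B} (hφθ : ∀ n, φ (θ n) = θ n ^ p)
    (hπθ : IsRootTower p fun n => π (θ n))
    (hθ : HasPseudoLimits fun n => ∏ m ∈ Finset.range n, θ m) : FrobSurj p R := by
  refine frobenius_surjective_of_lift hp hφs
    (s := (WittVector.map π).comp (wittLift hφ hB)) (fun b => ?_) (fun r => ?_) hθ fun n => ?_
  · rw [RingHom.comp_apply, ← map_frobenius, frobenius_wittLift, RingHom.comp_apply]
  · obtain ⟨b, rfl⟩ := hπ r
    exact ⟨b, by simp only [RingHom.comp_apply, map_coeff, coeff_zero_wittLift]⟩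
  · have hprod : φ (∏ m ∈ Finset.range n, θ m) = (∏ m ∈ Finset.range n, θ m) ^ p := by
      rw [map_prod, ← Finset.prod_pow]
      exact Finset.prod_congr rfl fun m _ => hφθ m
    rw [RingHom.comp_apply, wittLift_eq_teichmuller hφ hB hprod, map_teichmuller, map_prod]
    exact hπθ.exists_teichmuller_prod_eq hp hJ n

end FrobeniusSurjective

section FrobSurj

variable {p : ℕ} [Fact p.Prime] {R : Type*} [CommRing R] (hF : FrobSurj p R)
include hF

theorem FrobSurj.truncFrobenius_surjective (n : ℕ) :
    Function.Surjective (truncFrobenius p R n) := by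
  intro y
  obtain ⟨y, rfl⟩ := truncate_surjective p n R y
  obtain ⟨x, rfl⟩ := hF y
  exact ⟨_, truncFrobenius_truncate p n x⟩

theorem FrobSurj.truncFrobeniusIter_surjective (n : ℕ) :
    Function.Surjective (truncFrobeniusIter p R n) := by
  induction n with
  | zero => exact Function.surjective_id
  | succ n ih =>
    rw [truncFrobeniusIter, RingHom.coe_comp]
    exact ih.comp (hF.truncFrobenius_surjective (n + 1))

theorem FrobSurj.teichDense : TeichDense p R := by
  intro x
  obtain ⟨z, rfl⟩ := hF x
  obtain ⟨y, hy⟩ := exists_eq_teichmuller_add_verschiebung z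
  refine ⟨z.coeff 0 ^ p, y, ?_⟩
  rw [hy, map_add, frobenius_teichmuller, frobenius_verschiebung, ← hy, mul_comm,
    add_sub_cancel_left]

end FrobSurj

section FrobIdeal

variable {p : ℕ} [hp : Fact p.Prime] {R : Type*} [CommRing R] {n : ℕ}

theorem frobIdeal_succ_le (n : ℕ) : frobIdeal p R (n + 1) ≤ frobIdeal p R n :=
  frobSet_succ_subset p R n

theorem mem_frobIdeal_succ_iff {x : R} :
    x ∈ frobIdeal p R (n + 1) ↔ ∃ s ∈ frobIdeal p R n, x ^ p = p * s :=
  Iff.rfl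

theorem natCast_mem_frobIdeal (n : ℕ) : (p : R) ∈ frobIdeal p R n := by
  induction n with
  | zero => trivial
  | succ n ih =>
    refine mem_frobIdeal_succ_iff.2 ⟨p ^ (p - 1),
      Ideal.pow_mem_of_mem _ ih _ (Nat.sub_pos_of_lt hp.out.one_lt), ?_⟩
    rw [← pow_succ', Nat.sub_add_cancel hp.out.one_le]

theorem sub_mem_of_ball_subset_ball {r s : R} {I J : Ideal R} (h : ball r I ⊆ ball s J) :
    r - s ∈ J :=
  h <| show r - r ∈ I by simp

theorem ball_subset_ball {r s : R} {I J : Ideal R} (hIJ : I ≤ J) (h : r - s ∈ J) :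
    ball r I ⊆ ball s J := fun x hx =>
  show x - s ∈ J from sub_add_sub_cancel x r s ▸ add_mem (hIJ hx) h

theorem exists_add_pow_sub_eq_mul_mem_frobIdeal {x r y z : R} (hx : x ^ p - r = p * z)
    (hy : y ∈ frobIdeal p R n) (hyz : ∃ w ∈ frobIdeal p R n, y ^ p + p * z = p * w) :
    ∃ w ∈ frobIdeal p R n, (x + y) ^ p - r = p * w := by
  obtain ⟨w, hw, hyw⟩ := hyz
  obtain ⟨q, hq⟩ := exists_add_pow_prime_eq hp.out x y
  exact ⟨w + q * x * y, add_mem hw (Ideal.mul_mem_left _ _ hy), by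
    linear_combination hq + hx + hyw⟩

theorem exists_pow_sub_eq_mul_mem_frobIdealInf (hreg : IsLeftRegular (p : R))
    (hballs : BallsIntersect p R) (hroot : ∀ r : R, ∃ x, (p : R) ∣ x ^ p - r)
    (hstep : ∀ n, ∀ z ∈ frobIdeal p R n, ∃ y ∈ frobIdeal p R (n + 1),
      ∃ w ∈ frobIdeal p R (n + 1), y ^ p + p * z = p * w) (r : R) :
    ∃ x, ∃ z ∈ frobIdealInf p R, x ^ p - r = p * z := by
  obtain ⟨x, hx⟩ := exists_seq_of_forall_exists_next
    (P := fun n x => ∃ z ∈ frobIdeal p R n, x ^ p - r = p * z)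
    (r := fun n x x' => x' - x ∈ frobIdeal p R (n + 1))
    (let ⟨x, z, hz⟩ := hroot r; ⟨x, z, trivial, hz⟩) fun n x ⟨z, hz, hxz⟩ => by
      obtain ⟨y, hy, hyz⟩ := hstep n z hz
      exact ⟨x + y, exists_add_pow_sub_eq_mul_mem_frobIdeal hxz hy hyz, by
        rwa [add_sub_cancel_left]⟩
  obtain ⟨y, hy⟩ := hballs x fun n =>
    ball_subset_ball (frobIdeal_succ_le n) (frobIdeal_succ_le n (hx n).2)
  have hroots : ∀ n, ∃ z ∈ frobIdeal p R n, y ^ p - r = p * z := fun n => by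
    have hd : y - x (n + 1) ∈ frobIdeal p R (n + 1) := Set.mem_iInter.1 hy (n + 1)
    obtain ⟨z, hz, hxz⟩ := (hx (n + 1)).1
    obtain ⟨s, hs, hds⟩ := mem_frobIdeal_succ_iff.1 hd
    simpa only [add_sub_cancel] using exists_add_pow_sub_eq_mul_mem_frobIdeal hxz
      (frobIdeal_succ_le n hd)
      ⟨s + z, add_mem hs (frobIdeal_succ_le n hz), by rw [hds, mul_add]⟩
  obtain ⟨z, -, hz⟩ := hroots 0
  refine ⟨y, z, (Ideal.mem_iInf).2 fun n => ?_, hz⟩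
  obtain ⟨z', hz', hyz'⟩ := hroots n
  rwa [hreg (hz.symm.trans hyz')]

end FrobIdeal

section Roots

variable {p : ℕ} {R : Type*} [CommRing R]

theorem surjective_quotient_pow_iff {I : Ideal R} {k : ℕ} :
    Function.Surjective (fun x : R ⧸ I => x ^ k) ↔ ∀ r, ∃ s, s ^ k - r ∈ I := by
  rw [← Ideal.Quotient.mk_surjective.of_comp_iff, Function.Surjective,
    Ideal.Quotient.mk_surjective.forall]
  simp only [Function.comp_apply, ← map_pow, Ideal.Quotient.eq]

theorem pthRootsModP_iff : PthRootsModP p R ↔ ∀ r : R, ∃ s, (p : R) ∣ s ^ p - r := by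
  simp only [PthRootsModP, surjective_quotient_pow_iff, Ideal.mem_span_singleton]

theorem PthRootsModP.pthRootsPMul (h : PthRootsModP p R) {ϖ : R} (hϖ : ϖ ^ p = p) :
    PthRootsPMul p R := by
  intro r
  obtain ⟨s, d, hd⟩ := pthRootsModP_iff.1 h r
  exact ⟨ϖ * s, d, by rw [mul_pow, hϖ]; linear_combination p * hd⟩

variable [hp : Fact p.Prime]

theorem PthRootsInf.pthRootsFinite (h : PthRootsInf p R) : PthRootsFinite p R := fun n _ =>
  surjective_quotient_pow_iff.2 fun r =>
    (surjective_quotient_pow_iff.1 h r).imp fun _ hs => Ideal.mul_mono_right (iInf_le _ n) hs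

theorem PthRootsPMul.pthRootNegP (h : PthRootsPMul p R) : PthRootNegP p R := by
  obtain ⟨r, hr⟩ := h (-1)
  exact ⟨r, p, by rwa [← pow_two, ← mul_neg_one], natCast_mem_frobIdeal 1⟩

theorem PthRootNegP.pthRootNegPWeak (h : PthRootNegP p R) : PthRootNegPWeak p R :=
  let ⟨r, s, hr, t, _, ht⟩ := h
  ⟨r, s, hr, p, hp.out.pos, t, ht⟩

theorem otherConditions_of_frobSurj (hF : FrobSurj p R) (hballs : BallsIntersect p R)
    (hinf : PthRootsInf p R) (hmod : PthRootsModP p R) {ϖ : R} (hϖ : ϖ ^ p = p) :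
    OtherConditions p R where
  frobSurjFinite n _ := hF.truncFrobenius_surjective n
  frobSurjFiniteTwo := hF.truncFrobenius_surjective 2
  teichDense := hF.teichDense
  teichInImage _ := hF _
  teichInImageFinite n _ _ := hF.truncFrobenius_surjective n _
  teichInImageFiniteTwo _ := hF.truncFrobenius_surjective 2 _
  vOneInImage := hF _
  vOneInImageFinite n _ := hF.truncFrobenius_surjective n _
  vPowOneInImageFinite n _ := hF.truncFrobenius_surjective n _
  vOneInImageFiniteTwo := hF.truncFrobenius_surjective 2 _
  frobIterSurj n _ := hF.truncFrobeniusIter_surjective n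
  frobIterSurjOne := hF.truncFrobenius_surjective 1
  ballsIntersect := hballs
  pthRootsInf := hinf
  pthRootsFinite := hinf.pthRootsFinite
  pthRootsFiniteOne := hinf.pthRootsFinite 1 le_rfl
  pthRootsPMul := hmod.pthRootsPMul hϖ
  pthRootNegP := (hmod.pthRootsPMul hϖ).pthRootNegP
  pthRootNegPWeak := (hmod.pthRootsPMul hϖ).pthRootNegP.pthRootNegPWeak
  pthRootsModP := hmod

end Roots

namespace IsRootTower

variable {p : ℕ} [hp : Fact p.Prime] {R : Type*} [CommRing R] {ϖ : ℕ → R} (hϖ : IsRootTower p ϖ)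
include hϖ

theorem prod_mem_frobIdeal (n : ℕ) :
    ∏ m ∈ Finset.range n, ϖ (m + 1) ∈ frobIdeal p R n := by
  induction n with
  | zero => trivial
  | succ n ih => exact mem_frobIdeal_succ_iff.2 ⟨_, ih, hϖ.prod_succ_pow n⟩

variable (hreg : IsLeftRegular (p : R)) (hdvd : ∀ n x, ϖ n ∣ x ^ p → ϖ (n + 1) ∣ x)
include hreg hdvd

theorem mem_frobIdeal_iff {n : ℕ} {x : R} :
    x ∈ frobIdeal p R n ↔ ∏ m ∈ Finset.range n, ϖ (m + 1) ∣ x := by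
  refine ⟨fun hx => ?_, fun h => Ideal.mem_of_dvd _ h (hϖ.prod_mem_frobIdeal n)⟩
  induction n generalizing x with
  | zero => simp
  | succ n ih =>
    obtain ⟨y, rfl⟩ := ih (frobIdeal_succ_le n hx)
    obtain ⟨s, hs, hxs⟩ := mem_frobIdeal_succ_iff.1 hx
    obtain ⟨z, rfl⟩ := ih hs
    have hprod : IsLeftRegular (∏ m ∈ Finset.range n, ϖ m) :=
      IsLeftRegular.prod fun m _ => hϖ.isLeftRegular hreg m
    have hy : y ^ p = ϖ n * z := hprod <| by
      dsimp only
      rw [← hϖ.prod_pow, ← mul_pow, hxs, ← mul_assoc, ← hϖ.prod_succ_pow, hϖ.prod_pow,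
        hϖ.prod_pow, Finset.prod_range_succ, mul_assoc]
    rw [Finset.prod_range_succ]
    exact mul_dvd_mul_left _ (hdvd n y ⟨z, hy⟩)

theorem ballsIntersect (hlim : HasPseudoLimits fun n => ∏ m ∈ Finset.range n, ϖ (m + 1)) :
    BallsIntersect p R := by
  intro r hr
  obtain ⟨c, hc⟩ := hlim r fun n =>
    (hϖ.mem_frobIdeal_iff hreg hdvd).1 (sub_mem_of_ball_subset_ball (hr n))
  exact ⟨c, Set.mem_iInter.2 fun n => (hϖ.mem_frobIdeal_iff hreg hdvd).2 (hc n)⟩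

theorem pthRootsInf (hlim : HasPseudoLimits fun n => ∏ m ∈ Finset.range n, ϖ (m + 1))
    (hmod : PthRootsModP p R) : PthRootsInf p R := by
  have hroot := pthRootsModP_iff.1 hmod
  have hstep : ∀ n, ∀ z ∈ frobIdeal p R n, ∃ y ∈ frobIdeal p R (n + 1),
      ∃ w ∈ frobIdeal p R (n + 1), y ^ p + p * z = p * w := by
    intro n z hz
    obtain ⟨c, rfl⟩ := (hϖ.mem_frobIdeal_iff hreg hdvd).1 hz
    obtain ⟨s, d, hd⟩ := hroot (-c)
    refine ⟨(∏ m ∈ Finset.range (n + 1), ϖ (m + 1)) * s,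
      Ideal.mul_mem_right _ _ (hϖ.prod_mem_frobIdeal _),
      (∏ m ∈ Finset.range n, ϖ (m + 1)) * (p * d),
      Ideal.mul_mem_left _ _ (Ideal.mul_mem_right _ _ (natCast_mem_frobIdeal _)), ?_⟩
    rw [mul_pow, hϖ.prod_succ_pow]
    linear_combination p * (∏ m ∈ Finset.range n, ϖ (m + 1)) * hd
  refine surjective_quotient_pow_iff.2 fun r => ?_
  obtain ⟨x, z, hz, hxz⟩ := exists_pow_sub_eq_mul_mem_frobIdealInf hreg
    (hϖ.ballsIntersect hreg hdvd hlim) hroot hstep r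
  exact ⟨x, Ideal.mem_span_singleton_mul.2 ⟨z, hz, hxz.symm⟩⟩

end IsRootTower

section ReductionModP

variable {p : ℕ} {B R : Type*} [CommRing B] [CommRing R] {φ : B →+* B} (hφ : IsFrobeniusLift p φ)
include hφ

theorem IsFrobeniusLift.pthRootsModP (hφs : Function.Surjective φ) {π : B →+* R}
    (hπ : Function.Surjective π) : PthRootsModP p R := by
  rw [pthRootsModP_iff, hπ.forall]
  intro b
  obtain ⟨c, rfl⟩ := hφs b
  exact ⟨π c, by simpa using map_dvd π (dvd_sub_comm.1 (hφ c))⟩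

theorem IsFrobeniusLift.mem_span_pair_of_pow_mem (hbij : Function.Bijective φ) {a b : B}
    (h : b ^ p ∈ Ideal.span {φ a, (p : B)}) : b ∈ Ideal.span {a, (p : B)} := by
  obtain ⟨u, v, huv⟩ := Ideal.mem_span_pair.1 h
  obtain ⟨d, hd⟩ := hφ b
  obtain ⟨u, rfl⟩ := hbij.2 u
  obtain ⟨w, hw⟩ := hbij.2 (v + d)
  refine Ideal.mem_span_pair.2 ⟨u, w, hbij.1 ?_⟩
  rw [map_add, map_mul, map_mul, map_natCast, hw]
  linear_combination huv - hd

theorem IsFrobeniusLift.dvd_of_dvd_pow (hbij : Function.Bijective φ) {π : B →+* R}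
    (hπ : Function.Surjective π) {a : B} (hker : RingHom.ker π ≤ Ideal.span {φ a, (p : B)})
    (ha : π a ∣ p) {x : R} (h : π (φ a) ∣ x ^ p) : π a ∣ x := by
  obtain ⟨b, rfl⟩ := hπ x
  obtain ⟨y, hy⟩ := h
  obtain ⟨c, rfl⟩ := hπ y
  have hmem : b ^ p - φ a * c ∈ RingHom.ker π := by
    rw [RingHom.mem_ker, map_sub, map_pow, map_mul, hy, sub_self]
  have hpow : b ^ p ∈ Ideal.span {φ a, (p : B)} :=
    (Submodule.sub_mem_iff_left _ <| Ideal.mul_mem_right c _ <|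
      Ideal.subset_span <| Set.mem_insert _ _).1 (hker hmem)
  obtain ⟨u, v, rfl⟩ := Ideal.mem_span_pair.1 (hφ.mem_span_pair_of_pow_mem hbij hpow)
  rw [map_add, map_mul, map_mul, map_natCast]
  exact dvd_add (dvd_mul_left _ _) (ha.mul_left _)

end ReductionModP

section HahnSeries

open HahnSeries
open scoped Pointwise

theorem isPWO_preimage {α β : Type*} [Preorder α] [Preorder β] (f : α ↪o β) {s : Set β}
    (hs : s.IsPWO) : (f ⁻¹' s).IsPWO :=
  Set.partiallyWellOrderedOn_iff_exists_lt.2 fun g hg => by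
    simpa using hs.exists_lt (f := f ∘ g) hg

theorem C_dvd_iff {Γ A : Type*} [AddCommMonoid Γ] [PartialOrder Γ] [IsOrderedCancelAddMonoid Γ]
    [CommRing A] {a : A} {x : HahnSeries Γ A} : C a ∣ x ↔ ∀ i, a ∣ x.coeff i := by
  classical
  constructor
  · rintro ⟨y, rfl⟩ i
    simp
  · intro h
    choose c hc using h
    refine ⟨⟨fun i => if x.coeff i = 0 then 0 else c i, x.isPWO_support.mono fun i hi => ?_⟩, ?_⟩
    · exact fun hxi => hi (if_pos hxi)
    · ext i
      rw [C_mul_eq_smul, coeff_smul, smul_eq_mul]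
      dsimp only
      split_ifs with hxi
      · rw [hxi, mul_zero]
      · exact hc i

theorem isLeftRegular_C {Γ A : Type*} [AddCommMonoid Γ] [PartialOrder Γ]
    [IsOrderedCancelAddMonoid Γ] [CommRing A] {a : A} (ha : IsLeftRegular a) :
    IsLeftRegular (C a : HahnSeries Γ A) := fun x y h => by
  ext i
  refine ha ?_
  simpa [C_mul_eq_smul] using congrArg (coeff · i) h

theorem prod_single {Γ A ι : Type*} [AddCommMonoid Γ] [PartialOrder Γ]
    [IsOrderedCancelAddMonoid Γ] [CommRing A] (s : Finset ι) (γ : ι → Γ) :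
    ∏ m ∈ s, single (γ m) (1 : A) = single (∑ m ∈ s, γ m) 1 := by
  classical
  induction s using Finset.induction_on with
  | empty => simp
  | insert m s hm ih => simp [hm, ih]

theorem isLeftRegular_single {Γ A : Type*} [AddCommMonoid Γ] [PartialOrder Γ]
    [IsOrderedCancelAddMonoid Γ] [CommRing A] (a : Γ) :
    IsLeftRegular (single a (1 : A)) := fun x y h => by
  ext i
  simpa [coeff_single_mul_add] using congrArg (coeff · (i + a)) h

section Canonical

variable {Γ A : Type*} [AddCommMonoid Γ] [LinearOrder Γ] [IsOrderedCancelAddMonoid Γ]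
  [CanonicallyOrderedAdd Γ] [CommRing A]

theorem coeff_single_mul_of_lt {a i : Γ} (h : i < a) (r : A) (x : HahnSeries Γ A) :
    (single a r * x).coeff i = 0 := by
  by_contra hne
  obtain ⟨j, hj, k, -, rfl⟩ := support_mul_subset ((mem_support _ _).2 hne)
  rw [eq_of_mem_support_single hj] at h
  exact h.not_ge le_self_add

theorem single_dvd_iff {a : Γ} {x : HahnSeries Γ A} :
    single a 1 ∣ x ↔ ∀ i < a, x.coeff i = 0 := by
  constructor
  · rintro ⟨y, rfl⟩ i hi
    exact coeff_single_mul_of_lt hi 1 y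
  · intro h
    refine ⟨⟨fun i => x.coeff (i + a), isPWO_preimage (OrderEmbedding.addRight a)
      x.isPWO_support⟩, ?_⟩
    ext i
    rcases lt_or_ge i a with hi | hi
    · rw [h i hi, coeff_single_mul_of_lt hi]
    · obtain ⟨k, rfl⟩ := exists_add_of_le hi
      rw [add_comm a, coeff_single_mul_add, one_mul]

theorem hasPseudoLimits_single {γ : ℕ → Γ} (hγ : Monotone γ) :
    HasPseudoLimits fun n => single (γ n) (1 : A) := by
  classical
  intro b hb
  have hcoeff : ∀ m n, m ≤ n → ∀ i < γ m, (b n).coeff i = (b m).coeff i := by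
    intro m n hmn i hi
    induction n, hmn using Nat.le_induction with
    | base => rfl
    | succ n hmn ih =>
      rw [← ih, ← sub_eq_zero, ← coeff_sub]
      exact single_dvd_iff.1 (hb n) i (hi.trans_le (hγ hmn))
  let f : Γ → A := fun i => if h : ∃ n, i < γ n then (b (Nat.find h)).coeff i else 0
  have hf : ∀ n, ∀ i < γ n, f i = (b n).coeff i := by
    intro n i hi
    have h : ∃ n, i < γ n := ⟨n, hi⟩
    simp only [f, dif_pos h]
    exact (hcoeff _ _ (Nat.find_min' h hi) i (Nat.find_spec h)).symm
  have hpwo : (Function.support f).IsPWO := by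
    refine Set.isPWO_iff_isWF.2 <| Set.isWF_iff_no_descending_seq.2 fun g hg hmem => ?_
    obtain ⟨n, hn⟩ : ∃ n, g 0 < γ n := not_imp_comm.1 (fun h => dif_neg h) (hmem 0)
    refine Set.isWF_iff_no_descending_seq.1 (b n).isWF_support g hg fun k => ?_
    rw [mem_support, ← hf n _ ((hg.antitone (Nat.zero_le k)).trans_lt hn)]
    exact hmem k
  refine ⟨⟨f, hpwo⟩, fun n => single_dvd_iff.2 fun i hi => ?_⟩
  rw [coeff_sub, sub_eq_zero]
  exact hf n i hi

theorem isUnit_one_add_single_mul {a : Γ} (ha : 0 < a) (x : HahnSeries Γ A) :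
    IsUnit (1 + single a 1 * x) := by
  refine isUnit_of_orderTop_pos ?_
  rw [add_sub_cancel_left]
  exact (WithTop.coe_pos.2 ha).trans_le
    (orderTop_single_le.trans (le_self_add.trans orderTop_add_le_mul))

end Canonical

section CharP

variable {Γ A : Type*} [AddCommMonoid Γ] [LinearOrder Γ] [IsOrderedCancelAddMonoid Γ] [CommRing A]

theorem support_pow_subset (x : HahnSeries Γ A) (n : ℕ) : (x ^ n).support ⊆ n • x.support := by
  induction n with
  | zero => rw [pow_zero, zero_nsmul]; exact support_single_subset
  | succ n ih =>
    rw [pow_succ, succ_nsmul]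
    exact support_mul_subset.trans (Set.add_subset_add_right ih)

theorem coeff_pow_nsmul_of_forall_lt {x : HahnSeries Γ A} {c : Γ}
    (h : ∀ i, x.coeff i ≠ 0 → i < c) {n : ℕ} (hn : n ≠ 0) : (x ^ n).coeff (n • c) = 0 := by
  by_contra hne
  obtain ⟨f, hf, hsum⟩ := Set.mem_nsmul_iff_sum.1 (support_pow_subset x n hne)
  have : NeZero n := ⟨hn⟩
  refine (Finset.sum_lt_sum_of_nonempty (g := fun _ => c) (Finset.univ_nonempty (α := Fin n))
    fun i _ => h _ (hf i)).ne ?_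
  rw [hsum, Finset.sum_const, Finset.card_fin]

theorem coeff_pow_nsmul_of_forall_gt {x : HahnSeries Γ A} {c : Γ}
    (h : ∀ i, x.coeff i ≠ 0 → c < i) {n : ℕ} (hn : n ≠ 0) : (x ^ n).coeff (n • c) = 0 := by
  by_contra hne
  obtain ⟨f, hf, hsum⟩ := Set.mem_nsmul_iff_sum.1 (support_pow_subset x n hne)
  have : NeZero n := ⟨hn⟩
  refine (Finset.sum_lt_sum_of_nonempty (f := fun _ => c) (Finset.univ_nonempty (α := Fin n))
    fun i _ => h _ (hf i)).ne' ?_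
  rw [hsum, Finset.sum_const, Finset.card_fin]

theorem coeff_pow_char (p : ℕ) [hp : Fact p.Prime] [CharP A p] (x : HahnSeries Γ A) (i : Γ) :
    (x ^ p).coeff (p • i) = x.coeff i ^ p := by
  classical
  have : CharP (HahnSeries Γ A) p := charP_of_injective_ringHom (f := C) C_injective p
  set u := truncLT i x
  set v : HahnSeries Γ A := single i (x.coeff i)
  set w := x - u - v
  have hu : ∀ j, u.coeff j ≠ 0 → j < i := fun j hj =>
    lt_of_not_ge fun hij => hj (coeff_truncLT_of_le hij x)
  have hw : ∀ j, w.coeff j ≠ 0 → i < j := fun j hj => lt_of_not_ge fun hij => hj <| by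
    rcases lt_or_eq_of_le hij with h | rfl
    · simp [w, u, v, coeff_truncLT_of_lt h, coeff_single_of_ne h.ne]
    · simp [w, u, v]
  have hx : u + v + w = x := by simp only [w]; abel
  calc (x ^ p).coeff (p • i) = ((u + v + w) ^ p).coeff (p • i) := by rw [hx]
    _ = (v ^ p).coeff (p • i) := by
        rw [add_pow_char, add_pow_char, coeff_add, coeff_add,
          coeff_pow_nsmul_of_forall_lt hu hp.out.ne_zero,
          coeff_pow_nsmul_of_forall_gt hw hp.out.ne_zero, zero_add, add_zero]
    _ = x.coeff i ^ p := by rw [single_pow, coeff_single_same]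

end CharP

section FrobLift

variable {A : Type*} [CommRing A]

/-- The ring homomorphism between rings of generalized power series that applies `f` to every
coefficient. -/
noncomputable def mapCoeff {A' : Type*} [CommRing A'] (f : A →+* A') :
    GenPowerSeries A →+* GenPowerSeries A' where
  toFun x := x.map f
  map_one' := HahnSeries.map_one f.toMonoidWithZeroHom
  map_mul' _ _ := HahnSeries.map_mul f.toNonUnitalRingHom
  map_zero' := HahnSeries.map_zero f.toMonoidWithZeroHom.toZeroHom
  map_add' _ _ := HahnSeries.map_add f.toAddMonoidHom

variable (p : ℕ) [hp : Fact p.Prime] (σ : A →+* A)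

/-- The map `∑ c_i t^i ↦ ∑ σ(c_i) t^{pi}`, which lifts the Frobenius of `A⟦t^ℚ⟧ / p` when `σ`
lifts that of `A / p`. -/
noncomputable def frobLift : GenPowerSeries A →+* GenPowerSeries A :=
  (embDomainRingHom (AddMonoidHom.mulLeft (p : ℚ≥0))
    (mul_right_injective₀ (Nat.cast_ne_zero.2 hp.out.ne_zero)) (fun _ _ =>
      mul_le_mul_iff_right₀ (Nat.cast_pos.2 hp.out.pos))).comp
    (mapCoeff σ)

variable {p}

theorem coeff_frobLift_natCast_mul (x : GenPowerSeries A) (i : ℚ≥0) :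
    (frobLift p σ x).coeff (p * i) = σ (x.coeff i) :=
  embDomain_mk_coeff (f := AddMonoidHom.mulLeft (p : ℚ≥0)) _ _ (x := mapCoeff σ x) (a := i)

theorem exists_natCast_mul_eq (i : ℚ≥0) : ∃ j : ℚ≥0, p * j = i :=
  ⟨i / p, mul_div_cancel₀ i (Nat.cast_ne_zero.2 hp.out.ne_zero)⟩

theorem frobLift_single (i : ℚ≥0) : frobLift p σ (single i 1) = single (p * i) 1 := by
  ext j
  obtain ⟨j, rfl⟩ := exists_natCast_mul_eq (p := p) j
  simp [coeff_frobLift_natCast_mul, coeff_single, hp.out.ne_zero, apply_ite σ]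

variable {σ}

theorem frobLift_bijective (hσ : Function.Bijective σ) :
    Function.Bijective (frobLift p σ) := by
  constructor
  · intro x y h
    ext i
    exact hσ.1 (by simpa only [coeff_frobLift_natCast_mul] using congrArg (coeff · (p * i)) h)
  · intro y
    let e := RingEquiv.ofBijective σ hσ
    have hle : ∀ i j : ℚ≥0, p * i ≤ p * j ↔ i ≤ j := fun _ _ =>
      mul_le_mul_iff_right₀ (Nat.cast_pos.2 hp.out.pos)
    have hpwo := isPWO_preimage (OrderEmbedding.ofMapLEIff (fun i : ℚ≥0 => p * i) hle)
      y.isPWO_support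
    refine ⟨⟨fun i => e.symm (y.coeff (p * i)), hpwo.mono fun i hi h0 => hi ?_⟩, ?_⟩
    · exact (congrArg e.symm h0).trans (map_zero _)
    · ext i
      obtain ⟨i, rfl⟩ := exists_natCast_mul_eq (p := p) i
      rw [coeff_frobLift_natCast_mul]
      exact e.apply_symm_apply _

theorem IsFrobeniusLift.frobLift (hσ : IsFrobeniusLift p σ) :
    IsFrobeniusLift p (frobLift p σ) := by
  intro x
  by_cases hp' : IsUnit (p : A)
  · exact (by simpa using hp'.map (C : A →+* GenPowerSeries A) : IsUnit (p : GenPowerSeries A)).dvd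
  have : CharP (A ⧸ Ideal.span {(p : A)}) p := CharP.quotient A p hp'
  let q : A →+* A ⧸ Ideal.span {(p : A)} := Ideal.Quotient.mk _
  have hq : ∀ a, q a = 0 ↔ (p : A) ∣ a := fun a => by
    rw [Ideal.Quotient.eq_zero_iff_mem, Ideal.mem_span_singleton]
  rw [← map_natCast C p, C_dvd_iff]
  intro i
  obtain ⟨i, rfl⟩ := exists_natCast_mul_eq (p := p) i
  have hpow : q ((x ^ p).coeff (p * i)) = q (x.coeff i) ^ p := by
    have h := coeff_pow_char p (mapCoeff q x) i
    rwa [← map_pow, nsmul_eq_mul] at h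
  rw [← hq, coeff_sub, coeff_frobLift_natCast_mul, map_sub, hpow, ← map_pow, ← map_sub, hq]
  exact hσ _

end FrobLift

end HahnSeries

section Poonen

open HahnSeries

/-- The projection `A⟦t^ℚ⟧ → A⟦t^ℚ⟧ / (t - p)`. -/
noncomputable abbrev toPoonen (p : ℕ) (A : Type*) [CommRing A] :
    GenPowerSeries A →+* PoonenRing p A :=
  Ideal.Quotient.mk _

/-- The generalized power series `t ^ (1 / p ^ n)`. -/
noncomputable def rootT (p : ℕ) (A : Type*) [CommRing A] (n : ℕ) : GenPowerSeries A :=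
  single (p ^ n : ℚ≥0)⁻¹ 1

variable {p : ℕ} {A : Type*} [CommRing A]

theorem toPoonen_surjective : Function.Surjective (toPoonen p A) :=
  Ideal.Quotient.mk_surjective

theorem toPoonen_eq_zero_iff {b : GenPowerSeries A} :
    toPoonen p A b = 0 ↔ single (1 : ℚ≥0) (1 : A) - (p : GenPowerSeries A) ∣ b := by
  rw [Ideal.Quotient.eq_zero_iff_mem, Ideal.mem_span_singleton]

theorem toPoonen_single_one : toPoonen p A (single 1 1) = p := by
  rw [← sub_eq_zero, ← map_natCast (toPoonen p A), ← map_sub, toPoonen_eq_zero_iff]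

theorem coeff_natCast_mul (x : GenPowerSeries A) (i : ℚ≥0) :
    ((p : GenPowerSeries A) * x).coeff i = p * x.coeff i := by
  rw [← map_natCast C p, C_mul_eq_smul, coeff_smul, smul_eq_mul]

theorem isLeftRegular_natCast_genPowerSeries (hreg : IsLeftRegular (p : A)) :
    IsLeftRegular (p : GenPowerSeries A) := by
  rw [← map_natCast C p]
  exact isLeftRegular_C hreg

theorem isLeftRegular_natCast_poonenRing (hreg : IsLeftRegular (p : A)) :
    IsLeftRegular (p : PoonenRing p A) := by
  rw [isLeftRegular_iff_right_eq_zero_of_mul]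
  refine toPoonen_surjective.forall.2 fun b hb => ?_
  rw [← toPoonen_single_one, ← map_mul, toPoonen_eq_zero_iff] at hb
  obtain ⟨c, hc⟩ := hb
  obtain ⟨d, rfl⟩ : single (1 : ℚ≥0) (1 : A) ∣ c := by
    refine single_dvd_iff.2 fun i hi => (hreg.mul_left_eq_zero_iff).1 ?_
    have h : (p : GenPowerSeries A) * c = single 1 1 * (c - b) := by linear_combination hc
    rw [← coeff_natCast_mul, h, coeff_single_mul_of_lt hi]
  exact toPoonen_eq_zero_iff.2 ⟨d, isLeftRegular_single 1 (by linear_combination hc)⟩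

theorem natCast_mem_jacobson_poonenRing :
    (p : PoonenRing p A) ∈ Ideal.jacobson (⊥ : Ideal (PoonenRing p A)) := by
  refine Ideal.mem_jacobson_bot.2 (toPoonen_surjective.forall.2 fun b => ?_)
  have h := (isUnit_one_add_single_mul one_pos b).map (toPoonen p A)
  simpa only [map_add, map_one, map_mul, toPoonen_single_one, add_comm] using h

theorem not_pInvertible_poonenRing (hp : ¬ IsUnit (p : A)) : ¬ PInvertible p (PoonenRing p A) := by
  intro h
  obtain ⟨r, hr⟩ := h.exists_right_inv
  obtain ⟨b, rfl⟩ := toPoonen_surjective r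
  rw [← sub_eq_zero, ← toPoonen_single_one, ← map_mul, ← map_one (toPoonen p A), ← map_sub,
    toPoonen_eq_zero_iff] at hr
  obtain ⟨c, hc⟩ := hr
  have h : single 1 1 * (b - c) + (p : GenPowerSeries A) * c = 1 := by linear_combination hc
  have hcoeff := congrArg (HahnSeries.coeff · 0) h
  simp only [coeff_add, coeff_single_mul_of_lt one_pos, coeff_natCast_mul, coeff_one, if_pos,
    zero_add] at hcoeff
  exact hp (IsUnit.of_mul_eq_one _ hcoeff)

theorem rootT_zero : rootT p A 0 = single 1 1 := by
  rw [rootT, pow_zero, inv_one]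

theorem hasPseudoLimits_prod_rootT (f : ℕ → ℕ) :
    HasPseudoLimits fun n => ∏ m ∈ Finset.range n, rootT p A (f m) := by
  simp only [rootT, prod_single]
  exact hasPseudoLimits_single fun m n hmn =>
    Finset.sum_le_sum_of_subset (Finset.range_subset_range.2 hmn)

theorem hasPseudoLimits_prod_toPoonen_rootT (f : ℕ → ℕ) :
    HasPseudoLimits fun n => ∏ m ∈ Finset.range n, toPoonen p A (rootT p A (f m)) := by
  simp only [← map_prod]
  exact (hasPseudoLimits_prod_rootT f).map toPoonen_surjective

variable [hp : Fact p.Prime]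

theorem rootT_succ_pow (n : ℕ) : rootT p A (n + 1) ^ p = rootT p A n := by
  rw [rootT, rootT, single_pow, one_pow, nsmul_eq_mul, pow_succ', mul_inv,
    mul_inv_cancel_left₀ (Nat.cast_ne_zero.2 hp.out.ne_zero)]

theorem rootT_dvd_single_one (n : ℕ) : rootT p A n ∣ single 1 1 := by
  induction n with
  | zero => rw [rootT_zero]
  | succ n ih =>
    rw [← rootT_succ_pow] at ih
    exact (dvd_pow_self _ hp.out.ne_zero).trans ih

theorem isRootTower_toPoonen_rootT : IsRootTower p fun n => toPoonen p A (rootT p A n) where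
  zero := by rw [rootT_zero, toPoonen_single_one]
  succ_pow n := by rw [← map_pow, rootT_succ_pow]

theorem ker_toPoonen_le (n : ℕ) :
    RingHom.ker (toPoonen p A) ≤ Ideal.span {rootT p A n, (p : GenPowerSeries A)} := by
  rw [toPoonen, Ideal.mk_ker, Ideal.span_singleton_le_iff_mem]
  obtain ⟨d, hd⟩ := rootT_dvd_single_one (p := p) (A := A) n
  exact Ideal.mem_span_pair.2 ⟨d, -1, by linear_combination -hd⟩

variable {σ : A →+* A}

theorem frobLift_rootT (n : ℕ) : frobLift p σ (rootT p A n) = rootT p A n ^ p := by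
  rw [rootT, frobLift_single, single_pow, one_pow, nsmul_eq_mul]

theorem toPoonen_rootT_succ_dvd (hσ : IsFrobeniusLift p σ) (hbij : Function.Bijective σ) (n : ℕ)
    (x : PoonenRing p A) (hx : toPoonen p A (rootT p A n) ∣ x ^ p) :
    toPoonen p A (rootT p A (n + 1)) ∣ x := by
  have hφ : frobLift p σ (rootT p A (n + 1)) = rootT p A n :=
    (frobLift_rootT _).trans (rootT_succ_pow n)
  refine hσ.frobLift.dvd_of_dvd_pow (frobLift_bijective hbij) toPoonen_surjective ?_
    (isRootTower_toPoonen_rootT.dvd_natCast _) ?_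
  · exact hφ ▸ ker_toPoonen_le n
  · exact hφ ▸ hx

theorem frobSurj_poonenRing (hreg : IsLeftRegular (p : A)) (hσ : IsFrobeniusLift p σ)
    (hbij : Function.Bijective σ) : FrobSurj p (PoonenRing p A) :=
  hσ.frobLift.frobSurj (isLeftRegular_natCast_poonenRing hreg) natCast_mem_jacobson_poonenRing
    (isLeftRegular_natCast_genPowerSeries hreg) (frobLift_bijective hbij).2 toPoonen_surjective
    frobLift_rootT isRootTower_toPoonen_rootT (hasPseudoLimits_prod_rootT id)

theorem otherConditions_poonenRing (hreg : IsLeftRegular (p : A)) (hσ : IsFrobeniusLift p σ)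
    (hbij : Function.Bijective σ) : OtherConditions p (PoonenRing p A) := by
  have hroots := isRootTower_toPoonen_rootT (p := p) (A := A)
  have hregR := isLeftRegular_natCast_poonenRing hreg
  have hdvd := toPoonen_rootT_succ_dvd hσ hbij
  have hlim := hasPseudoLimits_prod_toPoonen_rootT (p := p) (A := A) (· + 1)
  have hmod : PthRootsModP p (PoonenRing p A) :=
    hσ.frobLift.pthRootsModP (frobLift_bijective hbij).2 toPoonen_surjective
  exact otherConditions_of_frobSurj (frobSurj_poonenRing hreg hσ hbij)
    (hroots.ballsIntersect hregR hdvd hlim) (hroots.pthRootsInf hregR hdvd hlim hmod) hmod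
    ((hroots.succ_pow 0).trans hroots.zero)

end Poonen

section FrobeniusLifts

variable (p : ℕ) [Fact p.Prime]

theorem isFrobeniusLift_id_padicInt : IsFrobeniusLift p (RingHom.id ℤ_[p]) := fun a => by
  rw [← Ideal.mem_span_singleton, ← PadicInt.maximalIdeal_eq_span_p, ← PadicInt.ker_toZMod,
    RingHom.mem_ker, map_sub, map_pow, ZMod.pow_card, RingHom.id_apply, sub_self]

theorem isFrobeniusLift_frobenius (k : Type*) [Field k] [CharP k p] [PerfectRing k p] :
    IsFrobeniusLift p (WittVector.frobenius : WittVector p k →+* WittVector p k) := fun a => by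
  rw [← Ideal.mem_span_singleton, WittVector.mem_span_p_iff_coeff_zero_eq_zero]
  change WittVector.constantCoeff (WittVector.frobenius a - a ^ p) = 0
  rw [map_sub, map_pow, sub_eq_zero]
  exact WittVector.coeff_frobenius_charP p a 0

end FrobeniusLifts

end WittFrobenius

theorem mainTheorem7_general (p : ℕ) [Fact p.Prime] {A : Type*} [CommRing A]
    (hreg : IsLeftRegular (p : A)) (hp : ¬ IsUnit (p : A)) {σ : A →+* A}
    (hσ : WittFrobenius.IsFrobeniusLift p σ) (hbij : Function.Bijective σ) :
    WittFrobenius.FrobSurj p (WittFrobenius.PoonenRing p A) ∧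
      WittFrobenius.OtherConditions p (WittFrobenius.PoonenRing p A) ∧
      ¬ WittFrobenius.PInvertible p (WittFrobenius.PoonenRing p A) :=
  ⟨WittFrobenius.frobSurj_poonenRing hreg hσ hbij,
    WittFrobenius.otherConditions_poonenRing hreg hσ hbij,
    WittFrobenius.not_pInvertible_poonenRing hp⟩

theorem mainTheorem7 (p : ℕ) [Fact p.Prime] :
    (WittFrobenius.FrobSurj p (WittFrobenius.PoonenRing p ℤ_[p]) ∧
      WittFrobenius.OtherConditions p (WittFrobenius.PoonenRing p ℤ_[p]) ∧
      ¬ WittFrobenius.PInvertible p (WittFrobenius.PoonenRing p ℤ_[p])) ∧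
    (WittFrobenius.FrobSurj p
        (WittFrobenius.PoonenRing p (WittVector p (AlgebraicClosure (ZMod p)))) ∧
      WittFrobenius.OtherConditions p
        (WittFrobenius.PoonenRing p (WittVector p (AlgebraicClosure (ZMod p)))) ∧
      ¬ WittFrobenius.PInvertible p
        (WittFrobenius.PoonenRing p (WittVector p (AlgebraicClosure (ZMod p))))) := by
  have hp : Prime (p : ℤ_[p]) := PadicInt.prime_p
  have hirr : Irreducible (p : WittVector p (AlgebraicClosure (ZMod p))) := WittVector.irreducible p
  exact ⟨mainTheorem7_general p (IsRegular.of_ne_zero hp.ne_zero).left hp.not_isUnit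
      (WittFrobenius.isFrobeniusLift_id_padicInt p) Function.bijective_id,
    mainTheorem7_general p (IsRegular.of_ne_zero hirr.ne_zero).left hirr.not_isUnit
      (WittFrobenius.isFrobeniusLift_frobenius p _) (WittVector.frobenius_bijective p _)⟩
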